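/- Fix $d\ge 1$ and let $U_1,U_2,\ldots$ be independent random points, each uniformly distributed on the upper half-sphere $\mathbb S^d_+=\{x=(x_0,\ldots,x_d)\in\mathbb R^{d+1}: \|x\|=1,\ x_0\ge 0\}$. For $n\ge 0$ let $C_n=\{\alpha_1U_1+\cdots+\alpha_nU_n:\alpha_1,\ldots,\alpha_n\ge 0\}$ be the random convex cone generated by $U_1,\ldots,U_n$. For a polyhedral cone $C\subset\mathbb R^{d+1}$ let $f_j(C)$ be the number of $j$-dimensional faces of $C$, where a face is the intersection of $C$ with a supporting hyperplane, and for $k\in\{0,\ldots,d\}$ let $$h_{k+1}(C)=\tfrac12\,\mathbb P(C\cap L\ne\{0\})$$ be its $(k+1)$st Grassmann angle, where $L$ is a random $(d+1-k)$-dimensional linear subspace of $\mathbb R^{d+1}$ distributed according to the unique rotation invariant probability measure on the Grassmannian $G(d+1,d+1-k)$. Then for all $k\in\{1,\ldots,d\}$ and all integers $n\ge 0$ the random variables $h_{k+1}(C_n)$ and $f_{d+1-k}(C_{n+d+1-k})$ are integrable, and $$2\binom{n+d+1-k}{d+1-k}\Big(\frac12-\mathbb E\,h_{k+1}(C_n)\Big)=\mathbb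 E\, f_{d+1-k}(C_{n+d+1-k}).$$ -/

import Mathlib

open MeasureTheory ProbabilityTheory

noncomputable section

namespace RandomCones

/-- The Euclidean space `ℝ^N`. -/
abbrev E (N : ℕ) : Type := EuclideanSpace ℝ (Fin N)

/-! ### The uniform distribution on the half-sphere -/

/-- The `d`-dimensional upper half-sphere in `ℝ^{d+1}`. -/
def halfSphere (d : ℕ) : Set (E (d + 1)) :=
  {x | ‖x‖ = 1 ∧ 0 ≤ x 0}

/-- The uniform distribution on the upper half-sphere: the surface measure of the unit sphere of
`ℝ^{d+1}`, seen as a measure on `ℝ^{d+1}`, restricted to the half-sphere and normalized to total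
mass one. -/
def uniformHalfSphere (d : ℕ) : Measure (E (d + 1)) :=
  ((volume : Measure (E (d + 1))).toSphere.map Subtype.val)[|halfSphere d]

/-- The positive hull `{α₁ v₁ + … + αₙ vₙ : αᵢ ≥ 0}` of `v₁, …, vₙ`. -/
def posHull {N n : ℕ} (v : Fin n → E N) : Set (E N) :=
  (PointedCone.hull ℝ (Set.range v) : Set (E N))

/-- The random cone `Cₙ = pos {U₁, …, Uₙ}` (the points are indexed from `0` here). -/
def cone {Ω : Type*} {N : ℕ} (U : ℕ → Ω → E N) (n : ℕ) (ω : Ω) : Set (E N) :=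
  posHull fun i : Fin n => U i ω

/-! ### Faces -/

/-- `F` is a face of the closed convex set `P`: the intersection of `P` with a supporting
hyperplane `{x | ⟪a, x⟫ = c}`, i.e. one that touches `P` and has `P` on one of its sides. -/
def IsFace {N : ℕ} (P F : Set (E N)) : Prop :=
  ∃ (a : E N) (c : ℝ), a ≠ 0 ∧ (∀ x ∈ P, c ≤ inner ℝ a x) ∧ (∃ x ∈ P, inner ℝ a x = c) ∧
    F = {x ∈ P | inner ℝ a x = c}

/-- `f_k(P)`: the number of faces of `P` whose affine hull has dimension `k`. -/
def faceCount {N : ℕ} (k : ℕ) (P : Set (E N)) : ℕ :=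
  {F : Set (E N) | IsFace P F ∧ Module.finrank ℝ (vectorSpan ℝ F) = k}.ncard

/-! ### The Grassmannian and its invariant probability measure -/

/-- The orthogonal group `O(N)`, as a group of (continuous) linear maps of `ℝ^N`, with the topology
induced by the operator norm. -/
abbrev O (N : ℕ) : Type := unitary (E N →L[ℝ] E N)

instance instContinuousStarEnd (N : ℕ) : ContinuousStar (E N →L[ℝ] E N) :=
  ⟨(ContinuousLinearMap.adjoint (𝕜 := ℝ) (E := E N) (F := E N)).continuous⟩

instance instCompactSpaceO (N : ℕ) : CompactSpace (O N) := by
  refine isCompact_iff_compactSpace.mp ?_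
  refine Metric.isCompact_of_isClosed_isBounded isClosed_unitary ?_
  refine (Metric.isBounded_closedBall (x := (0 : E N →L[ℝ] E N)) (r := 1)).subset ?_
  intro u hu
  rw [mem_closedBall_zero_iff]
  refine ContinuousLinearMap.opNorm_le_bound _ zero_le_one fun x => ?_
  have h := (Unitary.linearIsometryEquiv (⟨u, hu⟩ : O N)).norm_map x
  rw [one_mul]
  exact le_of_eq h

/-- The Haar probability measure on `O(N)`. -/
def haarO (N : ℕ) : Measure (O N) :=
  Measure.haarMeasure ⊤

/-- The Grassmannian `G(N, m)` of all `m`-dimensional linear subspaces of `ℝ^N`. -/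
def Gr (N m : ℕ) : Type :=
  {L : Submodule ℝ (E N) // Module.finrank ℝ L = m}

/-- The linear subspace spanned by the first `m` standard basis vectors of `ℝ^N`. -/
def coordSubspace {N m : ℕ} (h : m ≤ N) : Submodule ℝ (E N) :=
  Submodule.span ℝ (Set.range fun i : Fin m => EuclideanSpace.basisFun (Fin N) ℝ (Fin.castLE h i))

theorem finrank_coordSubspace {N m : ℕ} (h : m ≤ N) :
    Module.finrank ℝ (coordSubspace h) = m := by
  have hli : LinearIndependent ℝ
      fun i : Fin m => EuclideanSpace.basisFun (Fin N) ℝ (Fin.castLE h i) :=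
    (EuclideanSpace.basisFun (Fin N) ℝ).orthonormal.linearIndependent.comp _
      (Fin.castLE_injective h)
  have h' := finrank_span_eq_card hli
  rw [Fintype.card_fin] at h'
  exact h'

/-- The orbit map `O(N) → G(N, m)`, `g ↦ g L₀`, where `L₀` is spanned by the first `m` standard
basis vectors. It is onto. -/
def orbitMap {N m : ℕ} (h : m ≤ N) (g : O N) : Gr N m :=
  ⟨(coordSubspace h).map (Unitary.linearIsometryEquiv g).toLinearEquiv.toLinearMap, by
    rw [LinearEquiv.finrank_map_eq, finrank_coordSubspace h]⟩

/-- The topology of the Grassmannian as a homogeneous space of `O(N)`: the finest one for which the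
orbit maps are continuous. -/
instance instTopologicalSpaceGr (N m : ℕ) : TopologicalSpace (Gr N m) :=
  ⨆ h : m ≤ N, TopologicalSpace.coinduced (orbitMap h) inferInstance

instance instMeasurableSpaceGr (N m : ℕ) : MeasurableSpace (Gr N m) :=
  borel _

instance instBorelSpaceGr (N m : ℕ) : BorelSpace (Gr N m) :=
  ⟨rfl⟩

/-- The rotation invariant probability measure `ν_m` on `G(N, m)`: the image of the Haar
probability measure of `O(N)` under the orbit map. -/
def grassmannHaar {N m : ℕ} (h : m ≤ N) : Measure (Gr N m) :=
  (haarO N).map (orbitMap h)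

/-- The `j`-th Grassmann angle `h_j(C)` of a cone `C` in `ℝ^N`, for `j ∈ {1, …, N}`: one half of
the probability that `C` meets nontrivially a random linear subspace of codimension `j - 1` with
distribution `ν_{N-(j-1)}`. -/
def grassmannAngle {N : ℕ} (j : ℕ) (C : Set (E N)) : ℝ :=
  1 / 2 * (grassmannHaar (Nat.sub_le N (j - 1))).real {L | C ∩ (L.1 : Set (E N)) ≠ {0}}

end RandomCones

end

/-
Almost surely the generators of `C_{n+m}`, where `m = d + 1 - k`, are in general position. Its
`m`-dimensional faces then correspond to the `m`-element sets of generators cut out by a supporting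
hyperplane, and by Hahn–Banach a set is cut out in this way if and only if its span misses the
convex hull of the remaining `n` generators. The span of `m` independent uniform points of the
half-sphere is a uniformly distributed `m`-dimensional subspace: folding the sphere onto the
half-sphere changes no span, and averaging over a random rotation turns the span of uniform points
of the sphere into a random rotation of a fixed subspace. A given set of `m` generators therefore
spans a face with probability `1 - 2 E h_{k+1}(C_n)`, and there are `(n + m).choose m` such sets.
-/

namespace RandomCones

open Module Set

/-! ### Random vectors in general position -/

theorem span_range_ne_top_of_lt_finrank {ι V : Type*} [Fintype ι] [AddCommGroup V] [Module ℝ V]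
    (w : ι → V) (hw : Fintype.card ι < finrank ℝ V) : Submodule.span ℝ (range w) ≠ ⊤ :=
  fun htop => (finrank_range_le_card w).not_gt <| by rwa [Set.finrank, htop, finrank_top]

section NullOnProperSubspaces

variable {V : Type*} [NormedAddCommGroup V] [NormedSpace ℝ V] [MeasurableSpace V]

/-- The measure `ν` gives mass zero to every proper linear subspace. This is what puts independent
`ν`-distributed vectors in general position. -/
def NullOnProperSubspaces (ν : Measure V) : Prop :=
  ∀ S : Submodule ℝ V, S ≠ ⊤ → ν S = 0

theorem NullOnProperSubspaces.of_absolutelyContinuous {ν ρ : Measure V}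
    (hρ : NullOnProperSubspaces ρ) (h : ν ≪ ρ) : NullOnProperSubspaces ν :=
  fun S hS => h (hρ S hS)

theorem NullOnProperSubspaces.ae_ne_zero {ν : Measure V} (hν : NullOnProperSubspaces ν)
    {f : V →ₗ[ℝ] ℝ} (hf : f ≠ 0) : ∀ᵐ x ∂ν, f x ≠ 0 :=
  measure_eq_zero_iff_ae_notMem.1 (hν f.ker (mt LinearMap.ker_eq_top.1 hf))

theorem NullOnProperSubspaces.ae_linearIndependent_pi [FiniteDimensional ℝ V] [BorelSpace V]
    {ν : Measure V} [SigmaFinite ν] (hν : NullOnProperSubspaces ν) {m : ℕ}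
    (hm : m ≤ finrank ℝ V) : ∀ᵐ w ∂Measure.pi fun _ : Fin m => ν, LinearIndependent ℝ w := by
  induction m with
  | zero => exact .of_forall fun w => linearIndependent_empty_type
  | succ m ih =>
    have hmeas : MeasurableSet {p : V × (Fin m → V) |
        LinearIndependent ℝ (Fin.cons p.1 p.2 : Fin (m + 1) → V)} :=
      (isOpen_setOfPred_linearIndependent.preimage
        (continuous_fst.finCons continuous_snd)).measurableSet
    have hcons : ∀ᵐ p ∂ν.prod (Measure.pi fun _ : Fin m => ν),
        LinearIndependent ℝ (Fin.cons p.1 p.2 : Fin (m + 1) → V) := by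
      rw [Measure.ae_prod_iff_ae_ae hmeas, Measure.ae_ae_comm hmeas]
      filter_upwards [ih (Nat.le_of_succ_le hm)] with w hw
      filter_upwards [measure_eq_zero_iff_ae_notMem.1
        (hν _ (span_range_ne_top_of_lt_finrank w (by simpa using hm)))] with x hx
      exact linearIndependent_finCons.2 ⟨hw, hx⟩
    filter_upwards [(measurePreserving_piFinSuccAbove (fun _ : Fin (m + 1) => ν)
      0).quasiMeasurePreserving.ae hcons] with w hw
    rwa [← Fin.cons_self_tail w]

end NullOnProperSubspaces

/-! ### The uniform distribution on the sphere -/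

section Sphere

open scoped Pointwise

variable (V : Type*) [NormedAddCommGroup V] [InnerProductSpace ℝ V] [FiniteDimensional ℝ V]
  [MeasurableSpace V] [BorelSpace V]

/-- The surface measure of the unit sphere, seen as a measure on the ambient space. -/
noncomputable def sphereMeasure : Measure V :=
  (volume : Measure V).toSphere.map Subtype.val

/-- The uniform distribution on the unit sphere, seen as a measure on the ambient space. -/
noncomputable def sphereUniform : Measure V :=
  (sphereMeasure V)[|univ]

instance : IsFiniteMeasure (sphereMeasure V) := by
  unfold sphereMeasure; infer_instance

variable {V}

theorem sphereMeasure_apply {s : Set V} (hs : MeasurableSet s) :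
    sphereMeasure V s = finrank ℝ V * volume (Ioo (0 : ℝ) 1 • (Metric.sphere 0 1 ∩ s)) := by
  rw [sphereMeasure, Measure.map_apply measurable_subtype_coe hs,
    Measure.toSphere_apply' _ (measurable_subtype_coe hs), Subtype.image_preimage_coe]

theorem sphereMeasure_univ_ne_zero [Nontrivial V] : sphereMeasure V univ ≠ 0 := by
  rw [sphereMeasure, Measure.map_apply measurable_subtype_coe .univ, preimage_univ]
  exact (Measure.measure_univ_ne_zero).2 (Measure.toSphere_ne_zero _)

theorem ae_norm_eq_one_sphereMeasure : ∀ᵐ x ∂sphereMeasure V, ‖x‖ = 1 :=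
  (ae_map_iff measurable_subtype_coe.aemeasurable
    (measurableSet_eq_fun measurable_norm measurable_const)).2 (.of_forall norm_eq_of_mem_sphere)

theorem nullOnProperSubspaces_sphereMeasure : NullOnProperSubspaces (sphereMeasure V) := by
  intro S hS
  rw [sphereMeasure_apply S.closed_of_finiteDimensional.measurableSet]
  refine mul_eq_zero_of_right _ (measure_mono_null ?_ (Measure.addHaar_submodule volume S hS))
  rintro _ ⟨t, -, y, ⟨-, hy⟩, rfl⟩
  exact S.smul_mem t hy

theorem measurePreserving_sphereMeasure (g : V ≃ₗᵢ[ℝ] V) :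
    MeasurePreserving g (sphereMeasure V) (sphereMeasure V) := by
  have hg : Measurable g := g.continuous.measurable
  have hcone (s : Set V) : g ⁻¹' (Ioo (0 : ℝ) 1 • (Metric.sphere 0 1 ∩ s)) =
      Ioo (0 : ℝ) 1 • (Metric.sphere 0 1 ∩ g ⁻¹' s) := by
    ext x
    simp only [mem_preimage, mem_smul, mem_inter_iff, mem_sphere_zero_iff_norm]
    constructor
    · rintro ⟨t, ht, y, ⟨hy, hys⟩, h⟩
      exact ⟨t, ht, g.symm y, by simpa [hy] using hys, by rw [← map_smul, h, g.symm_apply_apply]⟩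
    · rintro ⟨t, ht, y, ⟨hy, hys⟩, rfl⟩
      exact ⟨t, ht, g y, ⟨(g.norm_map y).trans hy, hys⟩, (map_smul g t y).symm⟩
  refine ⟨hg, Measure.ext fun s hs => ?_⟩
  rw [Measure.map_apply hg hs, sphereMeasure_apply (hg hs), sphereMeasure_apply hs, ← hcone,
    g.measurePreserving.measure_preimage_emb g.toHomeomorph.measurableEmbedding]

instance [Nontrivial V] : IsProbabilityMeasure (sphereUniform V) :=
  cond_isProbabilityMeasure sphereMeasure_univ_ne_zero

theorem measurePreserving_sphereUniform (g : V ≃ₗᵢ[ℝ] V) :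
    MeasurePreserving g (sphereUniform V) (sphereUniform V) := by
  rw [sphereUniform, ProbabilityTheory.cond, Measure.restrict_univ]
  exact (measurePreserving_sphereMeasure g).smul_measure _

theorem nullOnProperSubspaces_sphereUniform : NullOnProperSubspaces (sphereUniform V) :=
  nullOnProperSubspaces_sphereMeasure.of_absolutelyContinuous cond_absolutelyContinuous

end Sphere

/-! ### Folding the sphere onto the half-sphere -/

section Fold

/-- The map that reflects the complement of `H` through the origin. When `H` is a half-sphere, it
folds the sphere onto `H`. -/
noncomputable def fold {G : Type*} [Neg G] (H : Set G) (x : G) : G :=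
  open Classical in if x ∈ H then x else -x

theorem fold_eq_or {G : Type*} [Neg G] (H : Set G) (x : G) : fold H x = x ∨ fold H x = -x := by
  unfold fold
  split_ifs <;> simp

section Measure

variable {G : Type*} [MeasurableSpace G] [InvolutiveNeg G] [MeasurableNeg G] {H : Set G}

theorem measurable_fold (hH : MeasurableSet H) : Measurable (fold H) :=
  open Classical in Measurable.ite hH measurable_id measurable_neg

variable {ρ : Measure G} [ρ.IsNegInvariant]

theorem measure_preimage_fold (hH : MeasurableSet H) (hneg : ∀ᵐ x ∂ρ, -x ∈ H ↔ x ∉ H)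
    (s : Set G) : ρ (fold H ⁻¹' s) = 2 * ρ (H ∩ s) := by
  have hin : fold H ⁻¹' s ∩ H = H ∩ s := by
    ext x
    by_cases hx : x ∈ H <;> simp [fold, hx]
  have hout : fold H ⁻¹' s \ H =ᵐ[ρ] Neg.neg ⁻¹' (H ∩ s) := by
    filter_upwards [hneg] with x hx
    apply propext
    change fold H x ∈ s ∧ x ∉ H ↔ -x ∈ H ∧ -x ∈ s
    rw [hx, and_comm]
    exact and_congr_right fun hxH => by rw [fold, if_neg hxH]
  have hreflect : ρ (fold H ⁻¹' s \ H) = ρ (H ∩ s) :=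
    (measure_congr hout).trans (Measure.measure_preimage_neg ρ _)
  rw [← measure_inter_add_sdiff _ hH, hin, hreflect, two_mul]

theorem cond_eq_map_fold (hH : MeasurableSet H) (hneg : ∀ᵐ x ∂ρ, -x ∈ H ↔ x ∉ H) :
    ρ[|H] = ρ[|univ].map (fold H) := by
  refine Measure.ext fun s hs => ?_
  have huniv : ρ univ = 2 * ρ H := by
    simpa only [preimage_univ, inter_univ] using measure_preimage_fold hH hneg univ
  rw [Measure.map_apply (measurable_fold hH) hs, cond_apply hH, cond_apply .univ, univ_inter,
    measure_preimage_fold hH hneg s, huniv,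
    ENNReal.mul_inv (.inl two_ne_zero) (.inl ENNReal.ofNat_ne_top), mul_mul_mul_comm,
    ENNReal.inv_mul_cancel two_ne_zero ENNReal.ofNat_ne_top, one_mul]

end Measure

theorem span_range_fold {ι V : Type*} [AddCommGroup V] [Module ℝ V] (H : Set V) (w : ι → V) :
    Submodule.span ℝ (range fun i => fold H (w i)) = Submodule.span ℝ (range w) := by
  apply le_antisymm <;> rw [Submodule.span_le] <;> rintro _ ⟨i, rfl⟩
  · have hi : w i ∈ Submodule.span ℝ (range w) := Submodule.subset_span ⟨i, rfl⟩
    rcases fold_eq_or H (w i) with h | h <;> simpa [h] using hi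
  · have hi : fold H (w i) ∈ Submodule.span ℝ (range fun i => fold H (w i)) :=
      Submodule.subset_span ⟨i, rfl⟩
    rcases fold_eq_or H (w i) with h | h <;> simpa [h] using hi

theorem linearIndependent_fold {ι V : Type*} [Finite ι] [AddCommGroup V] [Module ℝ V]
    (H : Set V) {w : ι → V} (hw : LinearIndependent ℝ w) :
    LinearIndependent ℝ fun i => fold H (w i) := by
  have := Fintype.ofFinite ι
  rw [linearIndependent_iff_card_eq_finrank_span] at hw ⊢
  rw [hw, Set.finrank, Set.finrank, span_range_fold]

end Fold

section HalfSphere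

variable {d : ℕ}

theorem measurable_coord_zero : Measurable fun x : E (d + 1) => x 0 := by
  fun_prop

theorem measurableSet_halfSphere : MeasurableSet (halfSphere d) :=
  (measurableSet_eq_fun measurable_norm measurable_const).inter
    (measurableSet_le measurable_const measurable_coord_zero)

theorem NullOnProperSubspaces.ae_coord_zero_ne_zero {ν : Measure (E (d + 1))}
    (hν : NullOnProperSubspaces ν) : ∀ᵐ x ∂ν, x 0 ≠ 0 := by
  refine hν.ae_ne_zero (f := (EuclideanSpace.proj (𝕜 := ℝ) (0 : Fin (d + 1))).toLinearMap) ?_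
  intro h
  simpa using LinearMap.congr_fun h (EuclideanSpace.single 0 1)

theorem uniformHalfSphere_eq_map_fold :
    uniformHalfSphere d = (sphereUniform (E (d + 1))).map (fold (halfSphere d)) := by
  have : (sphereMeasure (E (d + 1))).IsNegInvariant :=
    ⟨(measurePreserving_sphereMeasure (LinearIsometryEquiv.neg ℝ)).map_eq⟩
  change (sphereMeasure (E (d + 1)))[|halfSphere d] = _
  refine cond_eq_map_fold measurableSet_halfSphere ?_
  filter_upwards [ae_norm_eq_one_sphereMeasure,
    nullOnProperSubspaces_sphereMeasure.ae_coord_zero_ne_zero] with x hnorm hx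
  simp [halfSphere, hnorm, hx.le_iff_lt]

instance : IsProbabilityMeasure (uniformHalfSphere d) := by
  rw [uniformHalfSphere_eq_map_fold]
  exact Measure.isProbabilityMeasure_map (measurable_fold measurableSet_halfSphere).aemeasurable

theorem nullOnProperSubspaces_uniformHalfSphere : NullOnProperSubspaces (uniformHalfSphere d) :=
  (nullOnProperSubspaces_sphereMeasure (V := E (d + 1))).of_absolutelyContinuous
    cond_absolutelyContinuous

theorem ae_coord_zero_pos_uniformHalfSphere : ∀ᵐ x ∂uniformHalfSphere d, 0 < x 0 := by
  filter_upwards [ae_cond_mem measurableSet_halfSphere,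
    nullOnProperSubspaces_uniformHalfSphere.ae_coord_zero_ne_zero] with x hx hx0
  exact hx.2.lt_of_ne' hx0

end HalfSphere

/-! ### Rotations and the invariant distribution of random subspaces -/

theorem measure_eq_of_ae_measure_apply_mem_eq {G X : Type*} [MeasurableSpace G]
    [MeasurableSpace X] (ρ : Measure G) [IsProbabilityMeasure ρ] {ν : Measure X}
    [IsProbabilityMeasure ν] {φ : G → X → X} (hφ : Measurable fun p : G × X => φ p.1 p.2)
    (hν : ∀ g, MeasurePreserving (φ g) ν ν) {A : Set X} (hA : MeasurableSet A) {c : ENNReal}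
    (hc : ∀ᵐ x ∂ν, ρ {g | φ g x ∈ A} = c) : ν A = c :=
  calc
    ν A = ∫⁻ g, ν (φ g ⁻¹' A) ∂ρ := by
      simp only [(hν _).measure_preimage hA.nullMeasurableSet, lintegral_const, measure_univ,
        mul_one]
    _ = ∫⁻ x, ρ {g | φ g x ∈ A} ∂ν :=
      (Measure.prod_apply (hφ hA)).symm.trans (Measure.prod_apply_symm (hφ hA))
    _ = c := by rw [lintegral_congr_ae hc, lintegral_const, measure_univ, mul_one]

theorem exists_linearIsometryEquiv_map_eq {V : Type*} [NormedAddCommGroup V]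
    [InnerProductSpace ℝ V] [FiniteDimensional ℝ V] {S T : Submodule ℝ V}
    (h : finrank ℝ S = finrank ℝ T) :
    ∃ g : V ≃ₗᵢ[ℝ] V, S.map g.toLinearEquiv.toLinearMap = T := by
  let e : S ≃ₗᵢ[ℝ] T := (stdOrthonormalBasis ℝ S).equiv (stdOrthonormalBasis ℝ T) (finCongr h)
  let φ : V ≃ₗᵢ[ℝ] V :=
    (T.subtypeₗᵢ.comp e.toLinearIsometry).extend.toLinearIsometryEquiv rfl
  have hφ (x : S) : φ x = e x := LinearIsometry.extend_apply _ x
  refine ⟨φ, Submodule.eq_of_le_of_finrank_eq ?_ ((LinearEquiv.finrank_map_eq _ S).trans h)⟩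
  rintro _ ⟨x, hx, rfl⟩
  exact (hφ ⟨x, hx⟩).symm ▸ (e ⟨x, hx⟩).2

section HaarO

variable {N m : ℕ}

instance : (haarO N).IsHaarMeasure := by
  unfold haarO; infer_instance

instance : IsProbabilityMeasure (haarO N) :=
  ⟨Measure.haarMeasure_self (K₀ := (⊤ : TopologicalSpace.PositiveCompacts (O N)))⟩

instance : (haarO N).IsMulRightInvariant where
  map_mul_right_eq_self h := by
    have := Measure.isProbabilityMeasure_map (μ := haarO N)
      (continuous_mul_const h).measurable.aemeasurable
    exact Measure.isHaarMeasure_eq_of_isProbabilityMeasure _ _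

theorem continuous_linearIsometryEquiv_comp :
    Continuous fun p : O N × (Fin m → E N) => Unitary.linearIsometryEquiv p.1 ∘ p.2 :=
  continuous_pi fun i => (continuous_subtype_val.comp continuous_fst).clm_apply
    ((continuous_apply i).comp continuous_snd)

/-- Membership of a linearly independent family in `A` is a property of its span only. -/
def DependsOnlyOnSpan {ι V : Type*} [AddCommGroup V] [Module ℝ V] (A : Set (ι → V)) : Prop :=
  ∀ ⦃w w' : ι → V⦄, LinearIndependent ℝ w → LinearIndependent ℝ w' →
    Submodule.span ℝ (range w) = Submodule.span ℝ (range w') → (w ∈ A ↔ w' ∈ A)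

variable {A : Set (Fin m → E N)}

theorem DependsOnlyOnSpan.haarO_congr (hspan : DependsOnlyOnSpan A)
    {w w' : Fin m → E N} (hw : LinearIndependent ℝ w) (hw' : LinearIndependent ℝ w') :
    haarO N {g | Unitary.linearIsometryEquiv g ∘ w ∈ A} =
      haarO N {g | Unitary.linearIsometryEquiv g ∘ w' ∈ A} := by
  have hmap (g : E N ≃ₗᵢ[ℝ] E N) (u : Fin m → E N) : Submodule.span ℝ (range (g ∘ u)) =
      (Submodule.span ℝ (range u)).map g.toLinearEquiv.toLinearMap := by
    rw [Submodule.map_span, ← range_comp]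
    rfl
  have hli (g : E N ≃ₗᵢ[ℝ] E N) {u : Fin m → E N} (hu : LinearIndependent ℝ u) :
      LinearIndependent ℝ (g ∘ u) :=
    hu.map' g.toLinearEquiv.toLinearMap (LinearEquiv.ker _)
  -- Right translation by an isometry carrying the span of `w'` to that of `w` matches the two sets.
  obtain ⟨k, hk⟩ := exists_linearIsometryEquiv_map_eq
    ((finrank_span_eq_card hw').trans (finrank_span_eq_card hw).symm)
  rw [← measure_preimage_mul_right (haarO N) (Unitary.linearIsometryEquiv.symm k)
    {g | Unitary.linearIsometryEquiv g ∘ w' ∈ A}]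
  congr 1
  ext g
  refine hspan (hli _ hw) (hli _ hw') ?_
  rw [hmap, map_mul, hmap, MulEquiv.apply_symm_apply, ← hk, ← Submodule.map_comp]
  rfl

theorem DependsOnlyOnSpan.haarO_eq_pi (hA : MeasurableSet A) (hspan : DependsOnlyOnSpan A)
    {ν : Measure (E N)} [IsProbabilityMeasure ν] (hν : NullOnProperSubspaces ν)
    (hrot : ∀ g : E N ≃ₗᵢ[ℝ] E N, MeasurePreserving g ν ν) {w : Fin m → E N}
    (hw : LinearIndependent ℝ w) :
    haarO N {g | Unitary.linearIsometryEquiv g ∘ w ∈ A} = Measure.pi (fun _ : Fin m => ν) A := by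
  have hm : m ≤ finrank ℝ (E N) := by simpa using hw.fintype_card_le_finrank
  refine (measure_eq_of_ae_measure_apply_mem_eq (haarO N)
    continuous_linearIsometryEquiv_comp.measurable
    (fun g => measurePreserving_pi _ _ fun _ => hrot (Unitary.linearIsometryEquiv g)) hA ?_).symm
  filter_upwards [hν.ae_linearIndependent_pi hm] with w' hw'
  exact hspan.haarO_congr hw' hw

end HaarO

theorem DependsOnlyOnSpan.pi_uniformHalfSphere {d m : ℕ} {A : Set (Fin m → E (d + 1))}
    (hA : MeasurableSet A) (hspan : DependsOnlyOnSpan A) (hm : m ≤ d + 1) :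
    Measure.pi (fun _ => uniformHalfSphere d) A =
      Measure.pi (fun _ => sphereUniform (E (d + 1))) A := by
  have hmap : MeasurePreserving (fold (halfSphere d)) (sphereUniform (E (d + 1)))
      (uniformHalfSphere d) :=
    ⟨measurable_fold measurableSet_halfSphere, uniformHalfSphere_eq_map_fold.symm⟩
  rw [← (measurePreserving_pi _ _ fun _ : Fin m => hmap).measure_preimage hA.nullMeasurableSet]
  refine measure_congr ?_
  filter_upwards [nullOnProperSubspaces_sphereUniform.ae_linearIndependent_pi
    (V := E (d + 1)) (m := m) (by simpa using hm)] with w hw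
  exact propext (hspan (linearIndependent_fold _ hw) hw (span_range_fold _ w))

theorem DependsOnlyOnSpan.haarO_eq_pi_uniformHalfSphere {d m : ℕ} {A : Set (Fin m → E (d + 1))}
    (hA : MeasurableSet A) (hspan : DependsOnlyOnSpan A) {w : Fin m → E (d + 1)}
    (hw : LinearIndependent ℝ w) :
    haarO (d + 1) {g | Unitary.linearIsometryEquiv g ∘ w ∈ A} =
      Measure.pi (fun _ => uniformHalfSphere d) A :=
  (hspan.haarO_eq_pi hA nullOnProperSubspaces_sphereUniform measurePreserving_sphereUniform
    hw).trans (hspan.pi_uniformHalfSphere hA (by simpa using hw.fintype_card_le_finrank)).symm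

/-! ### Cones meeting subspaces -/

section Hull

variable {V : Type*} [AddCommGroup V] [Module ℝ V] {s : Set V}

theorem convexHull_subset_hull (s : Set V) : convexHull ℝ s ⊆ PointedCone.hull ℝ s :=
  convexHull_min PointedCone.subset_hull (PointedCone.convex _)

theorem eq_zero_or_mem_convexCone_hull {x : V} (hx : x ∈ PointedCone.hull ℝ s) :
    x = 0 ∨ x ∈ ConvexCone.hull ℝ s := by
  induction hx using Submodule.span_induction with
  | mem x hx => exact .inr (ConvexCone.subset_hull hx)
  | zero => exact .inl rfl
  | add x y _ _ hx hy =>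
    rcases hx with rfl | hx
    · rwa [zero_add]
    rcases hy with rfl | hy
    · exact .inr (by rwa [add_zero])
    · exact .inr (add_mem hx hy)
  | smul c x _ hx =>
    rcases hx with rfl | hx
    · exact .inl (smul_zero c)
    rcases eq_or_ne c 0 with rfl | hc
    · exact .inl (zero_smul _ x)
    · exact .inr (ConvexCone.smul_mem _ (c.2.lt_of_ne' (mt NNReal.coe_eq_zero.1 hc)) hx)

theorem exists_smul_mem_convexHull {x : V} (hx : x ∈ ConvexCone.hull ℝ s) :
    ∃ c : ℝ, c • x ∈ convexHull ℝ s := by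
  have hx' : x ∈ ConvexCone.hull ℝ (convexHull ℝ s) :=
    ConvexCone.hull_min ((subset_convexHull ℝ s).trans ConvexCone.subset_hull) hx
  obtain ⟨c, hc, y, hy, rfl⟩ := (ConvexCone.mem_hull_of_convex (convex_convexHull ℝ s)).1 hx'
  exact ⟨c⁻¹, by rwa [inv_smul_smul₀ hc.ne']⟩

theorem hull_inter_ne_zero_iff (hs : (0 : V) ∉ convexHull ℝ s) (L : Submodule ℝ V) :
    (PointedCone.hull ℝ s ∩ L : Set V) ≠ {0} ↔ ¬Disjoint (convexHull ℝ s) L := by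
  have h0 : (0 : V) ∈ (PointedCone.hull ℝ s ∩ L : Set V) := ⟨zero_mem _, zero_mem _⟩
  rw [not_iff_not, eq_singleton_iff_unique_mem, and_iff_right h0, disjoint_left]
  constructor
  · intro h x hx hxL
    exact hs (h x ⟨convexHull_subset_hull s hx, hxL⟩ ▸ hx)
  · rintro h x ⟨hx, hxL⟩
    refine (eq_zero_or_mem_convexCone_hull hx).resolve_right fun hx' => ?_
    obtain ⟨c, hc⟩ := exists_smul_mem_convexHull hx'
    exact h hc (L.smul_mem c hxL)

theorem pos_of_mem_convexHull {f : V →ₗ[ℝ] ℝ} (hf : ∀ x ∈ s, 0 < f x) {x : V}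
    (hx : x ∈ convexHull ℝ s) : 0 < f x :=
  convexHull_min hf (convex_halfSpace_gt f.isLinear 0) hx

theorem nonneg_of_mem_hull {f : V →ₗ[ℝ] ℝ} (hf : ∀ x ∈ s, 0 ≤ f x) {x : V}
    (hx : x ∈ PointedCone.hull ℝ s) : 0 ≤ f x :=
  (Submodule.span_le (p := (PointedCone.positive ℝ ℝ).comap f)).2 hf hx

theorem sep_hull_eq_hull_sep {f : V →ₗ[ℝ] ℝ} (hf : ∀ x ∈ s, 0 ≤ f x) :
    {x ∈ (PointedCone.hull ℝ s : Set V) | f x = 0} =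
      (PointedCone.hull ℝ {x ∈ s | f x = 0} : Set V) := by
  have hnonneg {x : V} (hx : x ∈ PointedCone.hull ℝ s) : 0 ≤ f x := nonneg_of_mem_hull hf hx
  refine Subset.antisymm ?_ fun x hx => ⟨Submodule.span_mono (sep_subset _ _) hx, ?_⟩
  · rintro x ⟨hx, hx0⟩
    induction hx using Submodule.span_induction with
    | mem x hx => exact PointedCone.subset_hull ⟨hx, hx0⟩
    | zero => exact zero_mem _
    | add x y hx hy ihx ihy =>
      rw [map_add, add_eq_zero_iff_of_nonneg (hnonneg hx) (hnonneg hy)] at hx0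
      exact add_mem (ihx hx0.1) (ihy hx0.2)
    | smul c x _ ih =>
      rcases eq_or_ne c 0 with rfl | hc
      · rw [zero_smul]
        exact zero_mem _
      · rw [LinearMap.map_smul_of_tower, smul_eq_zero_iff_right hc] at hx0
        exact Submodule.smul_mem _ c (ih hx0)
  · have hle : PointedCone.hull ℝ {x ∈ s | f x = 0} ≤ PointedCone.ofSubmodule f.ker :=
      Submodule.span_le.2 fun y hy => hy.2
    exact hle hx

theorem finrank_vectorSpan_hull (s : Set V) :
    finrank ℝ (vectorSpan ℝ (PointedCone.hull ℝ s : Set V)) = s.finrank ℝ := by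
  have h0 : (0 : V) ∈ (PointedCone.hull ℝ s : Set V) := zero_mem _
  have hspan : vectorSpan ℝ (PointedCone.hull ℝ s : Set V) = Submodule.span ℝ s := by
    rw [vectorSpan_eq_span_vsub_set_right ℝ h0]
    simp only [vsub_eq_sub, sub_zero, image_id']
    exact Submodule.span_span_of_tower _ _ _
  rw [hspan, Set.finrank]

end Hull

section MeetSet

variable {V : Type*} [NormedAddCommGroup V] [NormedSpace ℝ V]

theorem exists_strongDual_pos_of_disjoint {K : Set V} (hK : Convex ℝ K) (hKc : IsCompact K)
    {S : Submodule ℝ V} (hS : IsClosed (S : Set V)) (hdisj : Disjoint K S) :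
    ∃ f : StrongDual ℝ V, (∀ x ∈ S, f x = 0) ∧ ∀ x ∈ K, 0 < f x := by
  obtain ⟨f, s, t, hfK, hst, hfS⟩ :=
    geometric_hahn_banach_compact_closed hK hKc S.convex hS hdisj
  have ht : t < 0 := by simpa using hfS 0 S.zero_mem
  refine ⟨-f, fun x hx => neg_eq_zero.2 ?_, fun x hx => neg_pos.2 ((hfK x hx).trans (hst.trans ht))⟩
  by_contra! hne : f x ≠ 0
  simpa [hne] using hfS ((t / f x) • x) (S.smul_mem _ hx)

theorem exists_strongDual_ne_zero_pos_iff_disjoint [FiniteDimensional ℝ V] {s : Set V}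
    (hs : s.Finite) {S : Submodule ℝ V} (hS : S ≠ ⊤) :
    (∃ f : StrongDual ℝ V, f ≠ 0 ∧ (∀ x ∈ S, f x = 0) ∧ ∀ x ∈ s, 0 < f x) ↔
      Disjoint (convexHull ℝ s) S := by
  constructor
  · rintro ⟨f, -, hfS, hfs⟩
    exact disjoint_left.2 fun x hx hxS =>
      (pos_of_mem_convexHull (f := f.toLinearMap) hfs hx).ne' (hfS x hxS)
  · intro hdisj
    obtain ⟨f, hfS, hfK⟩ := exists_strongDual_pos_of_disjoint (convex_convexHull ℝ s)
      (hs.isCompact_convexHull ℝ) S.closed_of_finiteDimensional hdisj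
    have hfs (x) (hx : x ∈ s) : 0 < f x := hfK x (subset_convexHull ℝ s hx)
    rcases eq_or_ne f 0 with rfl | hf
    · obtain ⟨g, hg, hSg⟩ := S.exists_le_ker_of_lt_top hS.lt_top
      exact ⟨LinearMap.toContinuousLinearMap g, by simpa using hg, hSg,
        fun x hx => absurd (hfs x hx) (lt_irrefl 0)⟩
    · exact ⟨f, hf, hfS, hfs⟩

variable (V) in
/-- The pairs `(v, w)` for which the convex hull of `v` meets the span of `w`. Meeting is expressed
by linear dependence, which adds pairs with `w` linearly dependent and makes the set closed. -/
def meetSet (n m : ℕ) : Set ((Fin n → V) × (Fin m → V)) :=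
  {p | ∃ x ∈ convexHull ℝ (range p.1), ¬LinearIndependent ℝ (Fin.cons x p.2 : Fin (m + 1) → V)}

variable {n m : ℕ}

theorem mem_meetSet {v : Fin n → V} {w : Fin m → V} (hw : LinearIndependent ℝ w) :
    (v, w) ∈ meetSet V n m ↔
      ¬Disjoint (convexHull ℝ (range v)) (Submodule.span ℝ (range w)) := by
  simp [meetSet, linearIndependent_finCons, hw, not_disjoint_iff]

theorem convexHull_range_eq_image_stdSimplex {ι : Type*} [Fintype ι] (v : ι → V) :
    convexHull ℝ (range v) = (fun α => ∑ i, α i • v i) '' stdSimplex ℝ ι := by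
  classical
  rw [← convexHull_rangle_single_eq_stdSimplex]
  change _ = Fintype.linearCombination ℝ v '' _
  rw [LinearMap.image_convexHull, ← range_comp]
  congr 2
  ext i
  simp [Fintype.linearCombination_apply_single]

theorem isClosed_meetSet : IsClosed (meetSet V n m) := by
  have hcont : Continuous fun q : stdSimplex ℝ (Fin n) × ((Fin n → V) × (Fin m → V)) =>
      (Fin.cons (∑ i, q.1.1 i • q.2.1 i) q.2.2 : Fin (m + 1) → V) :=
    .finCons (continuous_finsetSum _ fun i _ =>
      .smul ((continuous_apply i).comp (continuous_subtype_val.comp continuous_fst))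
        (by fun_prop)) (by fun_prop)
  have hcl := ((isOpen_setOfPred_linearIndependent (𝕜 := ℝ)).preimage hcont).isClosed_compl
  convert isClosedMap_snd_of_compactSpace _ hcl using 1
  ext p
  simp [meetSet, convexHull_range_eq_image_stdSimplex]

theorem dependsOnlyOnSpan_meetSet (v : Fin n → V) :
    DependsOnlyOnSpan (Prod.mk v ⁻¹' meetSet V n m) := fun w w' hw hw' h => by
  rw [mem_preimage, mem_preimage, mem_meetSet hw, mem_meetSet hw', h]

end MeetSet

/-! ### Faces of cones over vectors in general position -/

section IsSupported

variable {ι V : Type*} [NormedAddCommGroup V] [NormedSpace ℝ V] {u : ι → V} {I : Finset ι}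

/-- The set `I` of generators is cut out of the family `u` by a supporting hyperplane of the cone
over `u`. Such a hyperplane passes through the origin, hence is the kernel of a functional. -/
def IsSupported (u : ι → V) (I : Finset ι) : Prop :=
  ∃ f : StrongDual ℝ V, f ≠ 0 ∧ (∀ i, 0 ≤ f (u i)) ∧ ∀ i, f (u i) = 0 ↔ i ∈ I

/-- Any `finrank ℝ V` or fewer of the vectors `u` are linearly independent. -/
def InGeneralPosition (u : ι → V) : Prop :=
  ∀ J : Finset ι, J.card ≤ finrank ℝ V → LinearIndependent ℝ fun i : J => u i

theorem sep_hull_range_eq_hull_image {f : StrongDual ℝ V} (hf : ∀ i, 0 ≤ f (u i))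
    (hI : ∀ i, f (u i) = 0 ↔ i ∈ I) :
    {x ∈ (PointedCone.hull ℝ (range u) : Set V) | f x = 0} = PointedCone.hull ℝ (u '' I) := by
  have hgen : {x ∈ range u | f x = 0} = u '' I := by
    ext x
    constructor
    · rintro ⟨⟨i, rfl⟩, hi⟩
      exact mem_image_of_mem u ((hI i).1 hi)
    · rintro ⟨i, hi, rfl⟩
      exact ⟨mem_range_self i, (hI i).2 hi⟩
  rw [← hgen]
  exact sep_hull_eq_hull_sep (f := f.toLinearMap) (forall_mem_range.2 hf)

theorem IsSupported.subset_of_hull_image_subset (hI : IsSupported u I) {J : Finset ι}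
    (h : (PointedCone.hull ℝ (u '' J) : Set V) ⊆ PointedCone.hull ℝ (u '' I)) : J ⊆ I := by
  obtain ⟨f, -, hf, hfI⟩ := hI
  intro i hi
  have hmem := h (PointedCone.subset_hull (mem_image_of_mem u hi))
  rw [← sep_hull_range_eq_hull_image hf hfI] at hmem
  exact (hfI i).1 hmem.2

theorem injOn_hull_image_isSupported (u : ι → V) :
    InjOn (fun I : Finset ι => (PointedCone.hull ℝ (u '' I) : Set V)) {I | IsSupported u I} :=
  fun _ hI _ hJ h => (hJ.subset_of_hull_image_subset h.le).antisymm
    (hI.subset_of_hull_image_subset h.ge)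

theorem IsSupported.card_lt [FiniteDimensional ℝ V] (hI : IsSupported u I)
    (hu : InGeneralPosition u) : I.card < finrank ℝ V := by
  obtain ⟨f, hf, -, hfI⟩ := hI
  by_contra! hcard
  obtain ⟨J, hJI, hJ⟩ := Finset.exists_subset_card_eq hcard
  have htop : Submodule.span ℝ (range fun i : J => u i) = ⊤ :=
    (hu J hJ.le).span_eq_top_of_card_eq_finrank' (by simp [hJ])
  exact hf (ContinuousLinearMap.coe_injective
    (LinearMap.ext_on_range htop fun i => (hfI i).2 (hJI i.2)))

theorem IsSupported.finrank_vectorSpan [FiniteDimensional ℝ V] (hI : IsSupported u I)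
    (hu : InGeneralPosition u) :
    finrank ℝ (vectorSpan ℝ (PointedCone.hull ℝ (u '' I) : Set V)) = I.card := by
  rw [finrank_vectorSpan_hull, image_eq_range]
  exact (finrank_span_eq_card (hu I (hI.card_lt hu).le)).trans (Fintype.card_coe I)

theorem isSupported_map_inr_iff_notMem_meetSet [FiniteDimensional ℝ V] {n m : ℕ}
    (e : Fin n ⊕ Fin m ≃ ι) (hw : LinearIndependent ℝ fun j => u (e (.inr j)))
    (hm : m < finrank ℝ V) :
    IsSupported u (Finset.univ.map (Function.Embedding.inr.trans e.toEmbedding)) ↔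
      ((fun i => u (e (.inl i))), fun j => u (e (.inr j))) ∉ meetSet V n m := by
  have hspan := span_range_ne_top_of_lt_finrank (fun j => u (e (.inr j))) (by simpa using hm)
  rw [mem_meetSet hw, not_not, ← exists_strongDual_ne_zero_pos_iff_disjoint (finite_range _) hspan]
  refine exists_congr fun f => and_congr_right fun _ => ?_
  change _ ↔ _ ≤ f.ker ∧ _
  rw [Submodule.span_le, range_subset_iff, forall_mem_range]
  constructor
  · rintro ⟨hf, hfI⟩
    exact ⟨fun j => (hfI _).2 (by simp), fun i => (hf _).lt_of_ne' (mt (hfI _).1 (by simp))⟩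
  · rintro ⟨h0, hpos⟩
    refine ⟨e.forall_congr_right.1 ?_, e.forall_congr_right.1 ?_⟩ <;>
      rw [Sum.forall]
    · exact ⟨fun i => (hpos i).le, fun j => (h0 j).ge⟩
    · exact ⟨fun i => by simpa using (hpos i).ne', fun j => by simpa using h0 j⟩

end IsSupported

theorem isFace_posHull_iff_exists_strongDual {N r : ℕ} {u : Fin r → E N} {F : Set (E N)} :
    IsFace (posHull u) F ↔ ∃ f : StrongDual ℝ (E N), f ≠ 0 ∧ (∀ i, 0 ≤ f (u i)) ∧
      {x ∈ posHull u | f x = 0} = F := by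
  have hzero : (0 : E N) ∈ posHull u := zero_mem (PointedCone.hull ℝ (range u))
  constructor
  · rintro ⟨a, c, ha, hc, ⟨y, hy, hyc⟩, rfl⟩
    have hc0 : c = 0 := by
      have h0 : c ≤ inner ℝ a (0 : E N) := hc 0 hzero
      have h2 : c ≤ inner ℝ a (y + y) := hc _ (add_mem (S := PointedCone ℝ (E N)) hy hy)
      rw [inner_zero_right] at h0
      rw [inner_add_right, hyc] at h2
      linarith
    subst hc0
    exact ⟨InnerProductSpace.toDual ℝ (E N) a, by simpa using ha,
      fun i => hc _ (PointedCone.subset_hull (mem_range_self i)), rfl⟩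
  · rintro ⟨f, hf, hnonneg, rfl⟩
    refine ⟨(InnerProductSpace.toDual ℝ (E N)).symm f, 0, by simpa using hf, fun x hx => ?_,
      ⟨0, hzero, inner_zero_right _⟩, by simp only [InnerProductSpace.toDual_symm_apply]⟩
    rw [InnerProductSpace.toDual_symm_apply]
    exact nonneg_of_mem_hull (f := f.toLinearMap) (forall_mem_range.2 hnonneg) hx

theorem isFace_posHull_iff {N r : ℕ} {u : Fin r → E N} {F : Set (E N)} :
    IsFace (posHull u) F ↔ ∃ I, IsSupported u I ∧ PointedCone.hull ℝ (u '' I) = F := by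
  classical
  rw [isFace_posHull_iff_exists_strongDual]
  constructor
  · rintro ⟨f, hf, hnonneg, rfl⟩
    have hI (i) : f (u i) = 0 ↔ i ∈ ({i | f (u i) = 0} : Finset (Fin r)) := by simp
    exact ⟨_, ⟨f, hf, hnonneg, hI⟩, (sep_hull_range_eq_hull_image hnonneg hI).symm⟩
  · rintro ⟨I, ⟨f, hf, hnonneg, hI⟩, rfl⟩
    exact ⟨f, hf, hnonneg, sep_hull_range_eq_hull_image hnonneg hI⟩

open Classical in
theorem faceCount_posHull {N r m : ℕ} {u : Fin r → E N} (hu : InGeneralPosition u) :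
    faceCount m (posHull u) = ((Finset.univ.powersetCard m).filter (IsSupported u)).card := by
  have hfaces : {F | IsFace (posHull u) F ∧ finrank ℝ (vectorSpan ℝ F) = m} =
      (fun I : Finset (Fin r) => (PointedCone.hull ℝ (u '' I) : Set (E N))) ''
        ((Finset.univ.powersetCard m).filter (IsSupported u)) := by
    ext F
    simp only [isFace_posHull_iff, mem_ofPred_eq, mem_image, Finset.mem_coe, Finset.mem_filter,
      Finset.mem_powersetCard_univ]
    constructor
    · rintro ⟨⟨I, hI, rfl⟩, hm⟩
      exact ⟨I, ⟨(hI.finrank_vectorSpan hu).symm.trans hm, hI⟩, rfl⟩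
    · rintro ⟨I, ⟨hm, hI⟩, rfl⟩
      exact ⟨⟨I, hI, rfl⟩, (hI.finrank_vectorSpan hu).trans hm⟩
  rw [faceCount, hfaces, InjOn.ncard_image, ncard_coe_finset]
  exact (injOn_hull_image_isSupported u).mono fun I hI => (Finset.mem_filter.1 hI).2

/-! ### Grassmann angles of random cones -/

section Grassmannian

variable {N m : ℕ}

theorem continuous_orbitMap (h : m ≤ N) : Continuous (orbitMap h) :=
  continuous_iff_coinduced_le.2
    (le_iSup (fun h : m ≤ N => TopologicalSpace.coinduced (orbitMap h) inferInstance) h)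

theorem isClosed_preimage_orbitMap_iff (h : m ≤ N) {s : Set (Gr N m)} :
    IsClosed (orbitMap h ⁻¹' s) ↔ IsClosed s := by
  refine ⟨fun hs => ?_, fun hs => hs.preimage (continuous_orbitMap h)⟩
  rw [← isOpen_compl_iff]
  exact isOpen_iSup_iff.2 fun _ => isOpen_coinduced.2 hs.isOpen_compl

theorem grassmannHaar_apply (h : m ≤ N) {s : Set (Gr N m)} (hs : MeasurableSet s) :
    grassmannHaar h s = haarO N (orbitMap h ⁻¹' s) :=
  Measure.map_apply (continuous_orbitMap h).measurable hs

theorem linearIndependent_basisFun_comp_castLE (h : m ≤ N) :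
    LinearIndependent ℝ (EuclideanSpace.basisFun (Fin N) ℝ ∘ Fin.castLE h) :=
  (EuclideanSpace.basisFun (Fin N) ℝ).orthonormal.linearIndependent.comp _
    (Fin.castLE_injective h)

theorem coe_orbitMap (h : m ≤ N) (g : O N) :
    (orbitMap h g).1 = Submodule.span ℝ (range (Unitary.linearIsometryEquiv g ∘
      EuclideanSpace.basisFun (Fin N) ℝ ∘ Fin.castLE h)) := by
  rw [range_comp]
  exact Submodule.map_span _ _

end Grassmannian

theorem grassmannHaar_posHull_inter_ne_zero {d n m : ℕ} (h : m ≤ d + 1)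
    {v : Fin n → E (d + 1)} (hv : ∀ i, 0 < v i 0) :
    grassmannHaar h {L | posHull v ∩ (L.1 : Set (E (d + 1))) ≠ {0}} =
      Measure.pi (fun _ => uniformHalfSphere d) (Prod.mk v ⁻¹' meetSet (E (d + 1)) n m) := by
  have h0 : (0 : E (d + 1)) ∉ convexHull ℝ (range v) := fun h0 =>
    (pos_of_mem_convexHull (f := (EuclideanSpace.proj (𝕜 := ℝ) (0 : Fin (d + 1))).toLinearMap)
      (forall_mem_range.2 hv) h0).ne' (map_zero _)
  have hw := linearIndependent_basisFun_comp_castLE h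
  have hpre : orbitMap h ⁻¹' {L | posHull v ∩ (L.1 : Set (E (d + 1))) ≠ {0}} =
      {g | Unitary.linearIsometryEquiv g ∘ EuclideanSpace.basisFun (Fin (d + 1)) ℝ ∘
        Fin.castLE h ∈ Prod.mk v ⁻¹' meetSet (E (d + 1)) n m} := by
    ext g
    have hgw := hw.map' (Unitary.linearIsometryEquiv g).toLinearEquiv.toLinearMap
      (LinearEquiv.ker _)
    change (PointedCone.hull ℝ (range v) ∩ (orbitMap h g).1 : Set (E (d + 1))) ≠ {0} ↔
      (v, _) ∈ meetSet _ n m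
    rw [hull_inter_ne_zero_iff h0, coe_orbitMap]
    exact (mem_meetSet hgw).symm
  have hsec : IsClosed (Prod.mk v ⁻¹' meetSet (E (d + 1)) n m) :=
    isClosed_meetSet.preimage (Continuous.prodMk_right v)
  have hcl : IsClosed {L : Gr (d + 1) m | posHull v ∩ (L.1 : Set (E (d + 1))) ≠ {0}} := by
    rw [← isClosed_preimage_orbitMap_iff h, hpre]
    exact hsec.preimage (continuous_linearIsometryEquiv_comp.comp (Continuous.prodMk_left _))
  rw [grassmannHaar_apply h hcl.measurableSet, hpre]
  exact (dependsOnlyOnSpan_meetSet v).haarO_eq_pi_uniformHalfSphere hsec.measurableSet hw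

/-! ### Expectations -/

section Expectation

variable {Ω : Type*} [MeasurableSpace Ω] {μ : Measure Ω}

theorem card_filter_eq_sum_indicator {α ι : Type*} (s : Finset ι) (p : α → ι → Prop) (a : α)
    [DecidablePred (p a)] :
    ((s.filter (p a)).card : ℝ) = ∑ i ∈ s, {a | p a i}.indicator 1 a := by
  simp [indicator_apply]

open Classical in
theorem integrable_card_filter [IsFiniteMeasure μ] {ι : Type*} (s : Finset ι)
    {p : Ω → ι → Prop} (hp : ∀ i ∈ s, NullMeasurableSet {ω | p ω i} μ) :
    Integrable (fun ω => ((s.filter (p ω)).card : ℝ)) μ := by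
  simp only [card_filter_eq_sum_indicator]
  exact integrable_finsetSum s fun i hi =>
    (integrable_const (1 : ℝ)).integrableOn.integrable_indicator₀ (hp i hi)

open Classical in
theorem integral_card_filter [IsFiniteMeasure μ] {ι : Type*} (s : Finset ι)
    {p : Ω → ι → Prop} (hp : ∀ i ∈ s, NullMeasurableSet {ω | p ω i} μ) :
    ∫ ω, ((s.filter (p ω)).card : ℝ) ∂μ = ∑ i ∈ s, μ.real {ω | p ω i} := by
  simp only [card_filter_eq_sum_indicator]
  refine (integral_finsetSum s fun i hi =>
    (integrable_const (1 : ℝ)).integrableOn.integrable_indicator₀ (hp i hi)).trans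
    (Finset.sum_congr rfl fun i hi => (integral_indicator₀ (hp i hi)).trans ?_)
  rw [integral_const, measureReal_restrict_apply_univ, smul_eq_mul, mul_one]

section Slices

variable {α β : Type*} [MeasurableSpace α] [MeasurableSpace β] {ν : Measure α} {ρ : Measure β}
  [IsFiniteMeasure ρ] {X : Ω → α} {s : Set (α × β)}

theorem integrable_measureReal_preimage_prodMk [IsFiniteMeasure ν] (hX : HasLaw X ν μ)
    (hs : MeasurableSet s) :
    Integrable (fun ω => ρ.real (Prod.mk (X ω) ⁻¹' s)) μ := by
  have h := Measure.integrable_measure_prodMk_left (μ := ν) (ν := ρ) hs (measure_ne_top _ _)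
  rw [← hX.map_eq] at h
  exact h.comp_aemeasurable hX.aemeasurable

theorem integral_measureReal_preimage_prodMk (hX : HasLaw X ν μ) (hs : MeasurableSet s) :
    ∫ ω, ρ.real (Prod.mk (X ω) ⁻¹' s) ∂μ = (ν.prod ρ).real s := by
  have hmeas : Measurable fun x => ρ (Prod.mk x ⁻¹' s) := measurable_measure_prodMk_left hs
  rw [measureReal_def, Measure.prod_apply hs, ← integral_toReal hmeas.aemeasurable
    (.of_forall fun x => measure_lt_top _ _)]
  exact hX.integral_comp hmeas.ennreal_toReal.aestronglyMeasurable

end Slices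

theorem exists_equiv_map_inr_eq {ι : Type*} [Fintype ι] {n m : ℕ}
    (hι : Fintype.card ι = n + m) {I : Finset ι} (hI : I.card = m) :
    ∃ e : Fin n ⊕ Fin m ≃ ι,
      Finset.univ.map (Function.Embedding.inr.trans e.toEmbedding) = I := by
  classical
  have hIc : Fintype.card {i // i ∉ I} = n := by
    rw [Fintype.card_subtype_compl, Fintype.card_coe, hι, hI, Nat.add_sub_cancel]
  let e : Fin n ⊕ Fin m ≃ ι := (Equiv.sumCongr (Fintype.equivFinOfCardEq hIc).symm
    (I.equivFinOfCardEq hI).symm).trans ((Equiv.sumComm _ _).trans (Equiv.sumCompl (· ∈ I)))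
  refine ⟨e, Finset.eq_of_subset_of_card_le ?_ (by simp [hI])⟩
  exact Finset.map_subset_iff_subset_preimage.2 fun j _ =>
    Finset.mem_preimage.2 ((I.equivFinOfCardEq hI).symm j).2

theorem hasLaw_sum_prod {ι V : Type*} [MeasurableSpace V] {ν : Measure V}
    [IsProbabilityMeasure ν] {u : ι → Ω → V} {n m : ℕ} (hlaw : ∀ i, HasLaw (u i) ν μ)
    (hindep : iIndepFun u μ) {e : Fin n ⊕ Fin m → ι} (he : e.Injective) :
    HasLaw (fun ω => ((fun i => u (e (.inl i)) ω), fun j => u (e (.inr j)) ω))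
      ((Measure.pi fun _ : Fin n => ν).prod (Measure.pi fun _ : Fin m => ν)) μ :=
  (measurePreserving_sumPiEquivProdPi fun _ : Fin n ⊕ Fin m => ν).hasLaw.fun_comp
    ((hindep.precomp he).hasLaw_pi fun i => hlaw (e i))

section Independent

variable {V ι : Type*} [NormedAddCommGroup V] [NormedSpace ℝ V] [FiniteDimensional ℝ V]
  [MeasurableSpace V] [BorelSpace V] {ν : Measure V} [IsProbabilityMeasure ν]

/-- For `ν` under which `m` independent vectors are almost surely linearly independent, this is the
probability that the convex hull of `n` independent `ν`-distributed vectors meets the span of `m`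
further ones. -/
noncomputable def meetProb (ν : Measure V) (n m : ℕ) : ℝ :=
  ((Measure.pi fun _ : Fin n => ν).prod (Measure.pi fun _ : Fin m => ν)).real (meetSet V n m)

variable {u : ι → Ω → V}

theorem ae_linearIndependent [Fintype ι] (hν : NullOnProperSubspaces ν)
    (hlaw : ∀ i, HasLaw (u i) ν μ) (hindep : iIndepFun u μ) (hι : Fintype.card ι ≤ finrank ℝ V) :
    ∀ᵐ ω ∂μ, LinearIndependent ℝ fun i => u i ω := by
  have e := (Fintype.equivFin ι).symm
  have hmeas : MeasurableSet {w : Fin (Fintype.card ι) → V | LinearIndependent ℝ w} :=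
    isOpen_setOfPred_linearIndependent.measurableSet
  filter_upwards [(((hindep.precomp e.injective).hasLaw_pi fun i => hlaw (e i)).ae_iff
    hmeas.mem).2 (hν.ae_linearIndependent_pi hι)] with ω hω
  exact (linearIndependent_equiv e).1 hω

theorem ae_inGeneralPosition [Countable ι] (hν : NullOnProperSubspaces ν)
    (hlaw : ∀ i, HasLaw (u i) ν μ) (hindep : iIndepFun u μ) :
    ∀ᵐ ω ∂μ, InGeneralPosition fun i => u i ω := by
  refine ae_all_iff.2 fun J => Filter.eventually_imp_distrib_left.2 fun hJ => ?_
  exact ae_linearIndependent hν (fun i : J => hlaw i) (hindep.precomp Subtype.val_injective)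
    (by rwa [Fintype.card_coe])

theorem exists_hasLaw_isSupported_iff_notMem_meetSet [Fintype ι] (hν : NullOnProperSubspaces ν)
    (hlaw : ∀ i, HasLaw (u i) ν μ) (hindep : iIndepFun u μ) {n m : ℕ}
    (hι : Fintype.card ι = n + m) (hm : m < finrank ℝ V) {I : Finset ι} (hI : I.card = m) :
    ∃ Y : Ω → (Fin n → V) × (Fin m → V),
      HasLaw Y ((Measure.pi fun _ : Fin n => ν).prod (Measure.pi fun _ : Fin m => ν)) μ ∧
        ∀ᵐ ω ∂μ, IsSupported (fun i => u i ω) I ↔ Y ω ∉ meetSet V n m := by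
  obtain ⟨e, rfl⟩ := exists_equiv_map_inr_eq hι hI
  refine ⟨_, hasLaw_sum_prod hlaw hindep e.injective, ?_⟩
  filter_upwards [ae_linearIndependent hν (fun j => hlaw (e (.inr j)))
    (hindep.precomp (e.injective.comp Sum.inr_injective)) (by simpa using hm.le)] with ω hω
  exact isSupported_map_inr_iff_notMem_meetSet e hω hm

theorem nullMeasurableSet_isSupported [Fintype ι] (hν : NullOnProperSubspaces ν)
    (hlaw : ∀ i, HasLaw (u i) ν μ) (hindep : iIndepFun u μ) {n m : ℕ}
    (hι : Fintype.card ι = n + m) (hm : m < finrank ℝ V) {I : Finset ι} (hI : I.card = m) :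
    NullMeasurableSet {ω | IsSupported (fun i => u i ω) I} μ := by
  obtain ⟨Y, hY, hiff⟩ :=
    exists_hasLaw_isSupported_iff_notMem_meetSet hν hlaw hindep hι hm hI
  exact (hY.aemeasurable.nullMeasurableSet_preimage isClosed_meetSet.measurableSet.compl).congr
    (hiff.mono fun ω hω => propext hω.symm)

theorem measureReal_isSupported [Fintype ι] (hν : NullOnProperSubspaces ν)
    (hlaw : ∀ i, HasLaw (u i) ν μ) (hindep : iIndepFun u μ) {n m : ℕ}
    (hι : Fintype.card ι = n + m) (hm : m < finrank ℝ V) {I : Finset ι} (hI : I.card = m) :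
    μ.real {ω | IsSupported (fun i => u i ω) I} = 1 - meetProb ν n m := by
  obtain ⟨Y, hY, hiff⟩ :=
    exists_hasLaw_isSupported_iff_notMem_meetSet hν hlaw hindep hι hm hI
  have hmeas : MeasurableSet (meetSet V n m) := isClosed_meetSet.measurableSet
  calc
    μ.real {ω | IsSupported (fun i => u i ω) I} = μ.real {ω | Y ω ∉ meetSet V n m} :=
      measureReal_congr (hiff.mono fun ω hω => propext hω)
    _ = _ := hY.measureReal_eq hmeas.compl
    _ = 1 - meetProb ν n m := probReal_compl_eq_one_sub hmeas

end Independent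

section FaceCount

variable {N n m : ℕ} {ν : Measure (E N)} [IsProbabilityMeasure ν] {U : ℕ → Ω → E N}

open Classical in
theorem faceCount_cone_ae_eq (hν : NullOnProperSubspaces ν) (hlaw : ∀ i, HasLaw (U i) ν μ)
    (hindep : iIndepFun U μ) (r m : ℕ) :
    (fun ω => (faceCount m (cone U r ω) : ℝ)) =ᵐ[μ] fun ω =>
      (((Finset.univ.powersetCard m).filter
        (IsSupported fun i : Fin r => U i ω)).card : ℝ) := by
  filter_upwards [ae_inGeneralPosition hν (fun i : Fin r => hlaw i)
    (hindep.precomp Fin.val_injective)] with ω hω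
  exact congrArg Nat.cast (faceCount_posHull hω)

theorem integrable_faceCount_cone (hν : NullOnProperSubspaces ν) (hlaw : ∀ i, HasLaw (U i) ν μ)
    (hindep : iIndepFun U μ) (hm : m < N) :
    Integrable (fun ω => (faceCount m (cone U (n + m) ω) : ℝ)) μ := by
  have := hindep.isProbabilityMeasure
  refine (integrable_card_filter _ fun I hI => ?_).congr
    (faceCount_cone_ae_eq hν hlaw hindep (n + m) m).symm
  exact nullMeasurableSet_isSupported hν (fun i : Fin (n + m) => hlaw i)
    (hindep.precomp Fin.val_injective) (Fintype.card_fin _) (by simpa using hm)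
    (Finset.mem_powersetCard_univ.1 hI)

theorem integral_faceCount_cone (hν : NullOnProperSubspaces ν) (hlaw : ∀ i, HasLaw (U i) ν μ)
    (hindep : iIndepFun U μ) (hm : m < N) :
    ∫ ω, (faceCount m (cone U (n + m) ω) : ℝ) ∂μ = (n + m).choose m * (1 - meetProb ν n m) := by
  have := hindep.isProbabilityMeasure
  have hlaw' (i : Fin (n + m)) : HasLaw (U i) ν μ := hlaw i
  have hindep' := hindep.precomp (Fin.val_injective (n := n + m))
  have hcard : Fintype.card (Fin (n + m)) = n + m := Fintype.card_fin _
  have hm' : m < finrank ℝ (E N) := by simpa using hm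
  rw [integral_congr_ae (faceCount_cone_ae_eq hν hlaw hindep (n + m) m),
    integral_card_filter _ fun I hI => nullMeasurableSet_isSupported hν hlaw' hindep' hcard hm'
      (Finset.mem_powersetCard_univ.1 hI),
    Finset.sum_congr rfl fun I hI => measureReal_isSupported hν hlaw' hindep' hcard hm'
      (Finset.mem_powersetCard_univ.1 hI),
    Finset.sum_const, Finset.card_powersetCard, Finset.card_univ, hcard, nsmul_eq_mul]

end FaceCount

section GrassmannAngle

variable {d : ℕ} {U : ℕ → Ω → E (d + 1)}

theorem grassmannAngle_cone_ae_eq (hlaw : ∀ i, HasLaw (U i) (uniformHalfSphere d) μ) (n k : ℕ) :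
    (fun ω => grassmannAngle (k + 1) (cone U n ω)) =ᵐ[μ] fun ω =>
      1 / 2 * (Measure.pi fun _ : Fin (d + 1 - k) => uniformHalfSphere d).real
        (Prod.mk (fun i : Fin n => U i ω) ⁻¹' meetSet (E (d + 1)) n (d + 1 - k)) := by
  have hpos : ∀ᵐ ω ∂μ, ∀ i, 0 < U i ω 0 := ae_all_iff.2 fun i =>
    ((hlaw i).ae_iff (measurableSet_lt measurable_const measurable_coord_zero).mem).2
      ae_coord_zero_pos_uniformHalfSphere
  filter_upwards [hpos] with ω hω
  exact congrArg (1 / 2 * ENNReal.toReal ·)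
    (grassmannHaar_posHull_inter_ne_zero (Nat.sub_le (d + 1) k) fun i => hω i)

theorem integrable_grassmannAngle_cone (hlaw : ∀ i, HasLaw (U i) (uniformHalfSphere d) μ)
    (hindep : iIndepFun U μ) (n k : ℕ) :
    Integrable (fun ω => grassmannAngle (k + 1) (cone U n ω)) μ :=
  ((integrable_measureReal_preimage_prodMk
    ((hindep.precomp Fin.val_injective).hasLaw_pi fun i : Fin n => hlaw i)
    isClosed_meetSet.measurableSet).const_mul _).congr (grassmannAngle_cone_ae_eq hlaw n k).symm

theorem integral_grassmannAngle_cone (hlaw : ∀ i, HasLaw (U i) (uniformHalfSphere d) μ)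
    (hindep : iIndepFun U μ) (n k : ℕ) :
    ∫ ω, grassmannAngle (k + 1) (cone U n ω) ∂μ =
      1 / 2 * meetProb (uniformHalfSphere d) n (d + 1 - k) := by
  rw [integral_congr_ae (grassmannAngle_cone_ae_eq hlaw n k), integral_const_mul,
    integral_measureReal_preimage_prodMk
      ((hindep.precomp Fin.val_injective).hasLaw_pi fun i : Fin n => hlaw i)
      isClosed_meetSet.measurableSet, meetProb]

end GrassmannAngle

end Expectation

end RandomCones

theorem theorem5 {Ω : Type*} [MeasurableSpace Ω] (μ : MeasureTheory.Measure Ω)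
    [MeasureTheory.IsProbabilityMeasure μ] (d : ℕ) (U : ℕ → Ω → RandomCones.E (d + 1))
    (hlaw : ∀ i, ProbabilityTheory.HasLaw (U i) (RandomCones.uniformHalfSphere d) μ)
    (hindep : ProbabilityTheory.iIndepFun U μ)
    (n k : ℕ) (hk1 : 1 ≤ k) (hkd : k ≤ d) :
    MeasureTheory.Integrable (fun ω => RandomCones.grassmannAngle (k + 1) (RandomCones.cone U n ω)) μ ∧
    MeasureTheory.Integrable
      (fun ω => (RandomCones.faceCount (d + 1 - k) (RandomCones.cone U (n + d + 1 - k) ω) : ℝ)) μ ∧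
    2 * ((n + d + 1 - k).choose (d + 1 - k) : ℝ) *
        (1 / 2 - ∫ ω, RandomCones.grassmannAngle (k + 1) (RandomCones.cone U n ω) ∂μ) =
      ∫ ω, (RandomCones.faceCount (d + 1 - k) (RandomCones.cone U (n + d + 1 - k) ω) : ℝ) ∂μ := by
  have hν := RandomCones.nullOnProperSubspaces_uniformHalfSphere (d := d)
  have hm : d + 1 - k < d + 1 := by omega
  rw [show n + d + 1 - k = n + (d + 1 - k) by omega]
  refine ⟨RandomCones.integrable_grassmannAngle_cone hlaw hindep n k,
    RandomCones.integrable_faceCount_cone hν hlaw hindep hm, ?_⟩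
  rw [RandomCones.integral_grassmannAngle_cone hlaw hindep,
    RandomCones.integral_faceCount_cone hν hlaw hindep hm]
  ring
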